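/- Let $H$ and $\mathcal H$ be (real or complex) Hilbert spaces with inner products $(\cdot,\cdot)$, $\langle\cdot,\cdot\rangle$ and norms $\|\cdot\|$, $|\cdot|$. Suppose that $H$ is compactly imbedded in $\mathcal H$, and let $c_0$ be a constant with $|u|\le c_0\|u\|$ for $u\in H$. Let $H_1,H_2$ be infinite-dimensional closed subspaces of $H$, and let $S_1$, $S_2$, $S_0$ be the orthogonal projectors in $H$ onto $H_1$, $H_2$ and $H_1\cap H_2$; put $T_2=I-S_2$ and $T_0=I-S_0$. For $j=1,2$ let $K_j:H_j\to H_j$ be defined by $(K_ju,v)=\langle u,v\rangle$ for $u,v\in H_j$. Let $\lambda_1^{-1}>\lambda_2^{-1}>\cdots$ be the distinct eigenvalues of $K_1$; fix $m\ge 1$, let $X_m$ be the eigenspace of $K_1$ for $\lambda_m^{-1}$ and $J_m=\dim X_m$. For $\varphi\in X_m$ let $\Psi_\varphi\in H_2$ be the vector with $(\Psi_\varphi,w)=(\varphi,w)-\lambda_m\langle\varphi,w\rangle$ for all $w\in H_2$. There are positive constants $\sigma_0$, $c$, $C$, depending only on $\lambda_1,\dots,\lambda_{m+1}$ and $c_0$,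 such that the following holds for all $H_1,H_2$ and $\sigma\le\sigma_0$ with $$|(S_1-S_2)u|^2\le\sigma\|u\|^2\qquad\text{for all }u\in H.$$ Counted with multiplicities, $K_2$ has exactly $J_m$ eigenvalues $\mu_1^{-1},\dots,\mu_{J_m}^{-1}$ in the interval $(\lambda_{m+1}^{-1}+c\sigma^{1/2},\ \lambda_{m-1}^{-1}-c\sigma^{1/2})$ (where $\lambda_0^{-1}=\infty$), these all lie in $[\lambda_m^{-1}-c\sigma^{1/2},\ \lambda_m^{-1}+c\sigma^{1/2}]$, and this interval also contains exactly $J_m$ eigenvalues of $K_2$. The maximum $$\rho_0=\max_{\varphi\in X_m,\ \|\varphi\|=1}\big(\|T_0\varphi\|^2+\|\Psi_\varphi\|^2\big)$$ exists, and: 1. $(\Psi_\varphi,\psi)=(\Psi_\varphi,T_0\psi)$ for all $\varphi,\psi\in X_m$; 2. $|\tau|\le C\rho_0$ for every eigenvalue $\tau$ (with eigenvector $0\ne\varphi\in X_m$) of the problem $$\frac1{\lambda_m}\Big((\Psi_\varphi,\Psi_\psi)-(T_2\varphi,T_2\psi)-(\Psi_\varphi,\psi)-(\varphi,\Psi_\psi)\Big)=\tau\,(S_2\varphi,S_2\psi)\qquad\text{for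 all }\psi\in X_m;$$ 3. $|\mu_k^{-1}-\lambda_m^{-1}|\le C\rho_0$ for $k=1,\dots,J_m$. -/

import Mathlib

noncomputable section

namespace EigPert

variable {𝕜 : Type*} [RCLike 𝕜]
  {H : Type*} [NormedAddCommGroup H] [InnerProductSpace 𝕜 H] [CompleteSpace H]
  {HH : Type*} [NormedAddCommGroup HH] [InnerProductSpace 𝕜 HH] [CompleteSpace HH]

instance (V : ClosedSubmodule 𝕜 H) : CompleteSpace V.toSubmodule :=
  V.isClosed'.completeSpace_coe

/-- The orthogonal projector of `H` onto the closed subspace `V`, as an operator in `H`. -/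
def proj (V : ClosedSubmodule 𝕜 H) : H →L[𝕜] H := V.toSubmodule.starProjection

/-- The complementary operator `T u = u - S u`, where `S` is the orthogonal projector onto `V`. -/
def coproj (V : ClosedSubmodule 𝕜 H) : H →L[𝕜] H := ContinuousLinearMap.id 𝕜 H - proj V

/-- The restriction to the closed subspace `V` of the imbedding `ι` of `H` into `HH`. -/
def incl (ι : H →L[𝕜] HH) (V : ClosedSubmodule 𝕜 H) : V.toSubmodule →L[𝕜] HH :=
  ι ∘L V.toSubmodule.subtypeL

/-- The operator `K : V → V` with `(K u, v) = ⟨u, v⟩` for `u, v ∈ V`, where `(·,·)` is the inner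
product of `H` and `⟨·,·⟩` that of `HH`; see `inner_opK`. -/
def opK (ι : H →L[𝕜] HH) (V : ClosedSubmodule 𝕜 H) : V.toSubmodule →L[𝕜] V.toSubmodule :=
  (incl ι V).adjoint ∘L incl ι V

theorem inner_opK (ι : H →L[𝕜] HH) (V : ClosedSubmodule 𝕜 H) (u v : V.toSubmodule) :
    inner 𝕜 (opK ι V u) v = inner 𝕜 (ι (u : H)) (ι (v : H)) := by
  simp [opK, incl, ContinuousLinearMap.adjoint_inner_left]

/-- The eigenspace of `K : V → V` for the eigenvalue `ν`. -/
def eigSp (ι : H →L[𝕜] HH) (V : ClosedSubmodule 𝕜 H) (ν : ℝ) : Submodule 𝕜 V.toSubmodule :=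
  Module.End.eigenspace (opK ι V : Module.End 𝕜 V.toSubmodule) (ν : 𝕜)

/-- The number `ν` is an eigenvalue of `K : V → V`. -/
def IsEig (ι : H →L[𝕜] HH) (V : ClosedSubmodule 𝕜 H) (ν : ℝ) : Prop :=
  Module.End.HasEigenvalue (opK ι V : Module.End 𝕜 V.toSubmodule) (ν : 𝕜)

/-- The number of eigenvalues of `K : V → V` in the set `s`, counted with multiplicities: the
dimension of the sum of the eigenspaces belonging to the points of `s`. -/
def eigCount (ι : H →L[𝕜] HH) (V : ClosedSubmodule 𝕜 H) (s : Set ℝ) : ℕ :=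
  Module.finrank 𝕜 (⨆ ν ∈ s, eigSp ι V ν : Submodule 𝕜 V.toSubmodule)

/-- `lam 0 < lam 1 < lam 2 < ⋯` are positive and `(lam j)⁻¹`, `j = 0, 1, 2, …`, are the distinct
eigenvalues of `K : V → V`. -/
structure IsEigenvalueSeq (ι : H →L[𝕜] HH) (V : ClosedSubmodule 𝕜 H) (lam : ℕ → ℝ) : Prop where
  pos : ∀ j, 0 < lam j
  strictMono : StrictMono lam
  isEig_iff : ∀ ν : ℝ, IsEig ι V ν ↔ ∃ j, ν = (lam j)⁻¹

/-- The vector `Ψ_φ ∈ V` with `(Ψ_φ, w) = (φ, w) - l ⟨φ, w⟩` for all `w ∈ V`;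
see `inner_psi` and `eq_psi`. -/
def psi (ι : H →L[𝕜] HH) (V : ClosedSubmodule 𝕜 H) (l : ℝ) (φ : H) : V.toSubmodule :=
  V.toSubmodule.orthogonalProjectionOnto φ - (l : 𝕜) • (incl ι V).adjoint (ι φ)

theorem inner_psi (ι : H →L[𝕜] HH) (V : ClosedSubmodule 𝕜 H) (l : ℝ) (φ : H)
    (w : V.toSubmodule) :
    inner 𝕜 (psi ι V l φ : H) (w : H)
      = inner 𝕜 φ (w : H) - (l : 𝕜) * inner 𝕜 (ι φ) (ι (w : H)) := by
  rw [← Submodule.coe_inner]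
  simp [psi, incl, inner_sub_left, inner_smul_left, ContinuousLinearMap.adjoint_inner_left]

theorem eq_psi (ι : H →L[𝕜] HH) (V : ClosedSubmodule 𝕜 H) (l : ℝ) (φ : H) (x : V.toSubmodule)
    (hx : ∀ w : V.toSubmodule, inner 𝕜 (x : H) (w : H)
      = inner 𝕜 φ (w : H) - (l : 𝕜) * inner 𝕜 (ι φ) (ι (w : H))) :
    x = psi ι V l φ := by
  refine ext_inner_right 𝕜 fun w => ?_
  rw [Submodule.coe_inner, Submodule.coe_inner, hx, inner_psi]

/-- The numbers `‖T₀ φ‖² + ‖Ψ_φ‖²`, where `φ` runs through the unit vectors of the eigenspace of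
`K₁ : H₁ → H₁` for the eigenvalue `l⁻¹`, the operator `T₀` is the complementary operator of
`H₁ ∩ H₂` and `Ψ_φ ∈ H₂`. -/
def rhoSet (ι : H →L[𝕜] HH) (H₁ H₂ : ClosedSubmodule 𝕜 H) (l : ℝ) : Set ℝ :=
  {r | ∃ φ : H₁.toSubmodule, φ ∈ eigSp ι H₁ l⁻¹ ∧ ‖φ‖ = 1 ∧
    r = ‖coproj (H₁ ⊓ H₂) (φ : H)‖ ^ 2 + ‖psi ι H₂ l (φ : H)‖ ^ 2}

/-- The quantity `ρ₀`, the maximum of `‖T₀ φ‖² + ‖Ψ_φ‖²` over the unit vectors of the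
eigenspace. -/
def rhoZero (ι : H →L[𝕜] HH) (H₁ H₂ : ClosedSubmodule 𝕜 H) (l : ℝ) : ℝ :=
  sSup (rhoSet ι H₁ H₂ l)

/-- `τ` is an eigenvalue of the problem
`l⁻¹ ((Ψ_φ, Ψ_χ) - (T φ, T χ) - (Ψ_φ, χ) - (φ, Ψ_χ)) = τ (S φ, S χ)` for all `χ ∈ X`,
with an eigenvector `φ ≠ 0` in `X`, where `X` is the eigenspace of `K₁ : H₁ → H₁` for the
eigenvalue `l⁻¹`, `S` is the orthogonal projector onto `H₂` and `T = I - S`. -/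
def IsTau (ι : H →L[𝕜] HH) (H₁ H₂ : ClosedSubmodule 𝕜 H) (l : ℝ) (τ : 𝕜) : Prop :=
  ∃ φ ∈ eigSp ι H₁ l⁻¹, φ ≠ 0 ∧ ∀ χ ∈ eigSp ι H₁ l⁻¹,
    ((l⁻¹ : ℝ) : 𝕜) *
      (inner 𝕜 (psi ι H₂ l (φ : H) : H) (psi ι H₂ l (χ : H) : H)
        - inner 𝕜 (coproj H₂ (φ : H)) (coproj H₂ (χ : H))
        - inner 𝕜 (psi ι H₂ l (φ : H) : H) (χ : H)
        - inner 𝕜 (φ : H) (psi ι H₂ l (χ : H) : H))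
      = τ * inner 𝕜 (proj H₂ (φ : H)) (proj H₂ (χ : H))

/-- The interval `((lam (m + 1))⁻¹ + r, (lam (m - 1))⁻¹ - r)`; its right end is `∞` if `m = 0`. -/
def gapInterval (lam : ℕ → ℝ) (m : ℕ) (r : ℝ) : Set ℝ :=
  {ν | (lam (m + 1))⁻¹ + r < ν ∧ ∀ j, j + 1 = m → ν < (lam j)⁻¹ - r}

/-- The interval `[(lam m)⁻¹ - r, (lam m)⁻¹ + r]`. -/
def nearInterval (lam : ℕ → ℝ) (m : ℕ) (r : ℝ) : Set ℝ :=
  Set.Icc ((lam m)⁻¹ - r) ((lam m)⁻¹ + r)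

end EigPert

end

/-! Extend `K₁`, `K₂` by zero to the compact symmetric operators `A = S₁ι*ιS₁` and `B = S₂ι*ιS₂` on
`H`; nonzero eigenvalues keep their eigenspaces. The hypothesis gives `‖A - B‖ ≤ r = 2c₀√σ`. Put `a
= λ_m⁻¹`, and let `g > 0` bound from below its distance to the rest of the spectrum of `A`.

An eigenvalue of `B` lies within `r` of the spectrum of `A`, so those in the gap interval lie within
`r` of `a`. Let `W` be their spectral subspace and `X` the eigenspace of `A`. For small `r` neither
contains a nonzero vector orthogonal to the other, so the dimensions agree and the orthogonal
projection of `X` to `W` is onto (`finrank_spectralSubspace_eq`).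

For an eigenvector `w ∈ W` of `B` at `ν`, choose `φ = w + z ∈ X` with `z ⟂ W`. Then `((B - a)φ, φ) =
(ν - a)‖w‖² + ((B - a)z, z)`, and the last term is at most a multiple of `‖(B - a)φ‖²`
(`abs_eigenvalue_sub_le`). Both the form and the squared residual are `O(ρ₀‖φ‖²)`: the only terms of
first order in the form are `(Ψ_φ, φ)` and its conjugate, and `Ψ_φ ⟂ H₁ ∩ H₂` turns `φ` into `T₀φ`
there (`inner_psi_eq_coproj`). The same remark bounds `τ`, given a lower bound for `‖S₂φ‖`. -/

noncomputable section

namespace EigPert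

open Module End

/-! ### Spectral subspaces of compact symmetric operators -/

section Spectral

variable {𝕜 : Type*} [RCLike 𝕜] {E : Type*} [NormedAddCommGroup E] [InnerProductSpace 𝕜 E]

/-- The sum of the eigenspaces of `T` belonging to the real eigenvalues in `s`. -/
def spectralSubspace (T : E →L[𝕜] E) (s : Set ℝ) : Submodule 𝕜 E :=
  ⨆ ν ∈ s, eigenspace (T : End 𝕜 E) (ν : 𝕜)

theorem spectralSubspace_singleton (T : E →L[𝕜] E) (a : ℝ) :
    spectralSubspace T {a} = eigenspace (T : End 𝕜 E) (a : 𝕜) := by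
  simp [spectralSubspace]

theorem eigenspace_le_spectralSubspace (T : E →L[𝕜] E) {s : Set ℝ} {ν : ℝ} (hν : ν ∈ s) :
    eigenspace (T : End 𝕜 E) (ν : 𝕜) ≤ spectralSubspace T s :=
  le_iSup₂_of_le ν hν le_rfl

theorem spectralSubspace_congr (T : E →L[𝕜] E) {s t : Set ℝ}
    (h : ∀ ν : ℝ, HasEigenvalue (T : End 𝕜 E) (ν : 𝕜) → (ν ∈ s ↔ ν ∈ t)) :
    spectralSubspace T s = spectralSubspace T t := by
  have key : ∀ {s t : Set ℝ}, (∀ ν : ℝ, HasEigenvalue (T : End 𝕜 E) (ν : 𝕜) → ν ∈ s → ν ∈ t) →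
      spectralSubspace T s ≤ spectralSubspace T t := by
    intro s t h
    refine iSup₂_le fun ν hν => ?_
    by_cases he : eigenspace (T : End 𝕜 E) (ν : 𝕜) = ⊥
    · simp [he]
    · exact eigenspace_le_spectralSubspace T (h ν (hasEigenvalue_iff.2 he) hν)
  exact le_antisymm (key fun ν h' => (h ν h').1) (key fun ν h' => (h ν h').2)

theorem map_mem_spectralSubspace (T : E →L[𝕜] E) (s : Set ℝ) {u : E}
    (hu : u ∈ spectralSubspace T s) : T u ∈ spectralSubspace T s := by
  have : spectralSubspace T s ≤ (spectralSubspace T s).comap (T : E →ₗ[𝕜] E) := by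
    refine iSup₂_le fun ν hν v hv => ?_
    have hv' : T v = (ν : 𝕜) • v := by simpa using mem_eigenspace_iff.1 hv
    rw [Submodule.mem_comap]
    change T v ∈ _
    rw [hv']
    exact Submodule.smul_mem _ _ (eigenspace_le_spectralSubspace T hν hv)
  exact this hu

/-- Pythagoras for the orthogonal eigenspaces. Expanding both norms in the same components reduces
bounds on `T - a` to scalar inequalities at genuine eigenvalues. -/
theorem exists_sum_of_mem_spectralSubspace {T : E →L[𝕜] E} (hT : T.IsSymmetric) {s : Set ℝ}
    {u : E} (hu : u ∈ spectralSubspace T s) (a : ℝ) :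
    ∃ (F : Finset s) (n : s → ℝ), (∀ i ∈ F, HasEigenvalue (T : End 𝕜 E) ((i : ℝ) : 𝕜)) ∧
      ‖u‖ ^ 2 = ∑ i ∈ F, n i ^ 2 ∧
      ‖T u - (a : 𝕜) • u‖ ^ 2 = ∑ i ∈ F, ((i : ℝ) - a) ^ 2 * n i ^ 2 := by
  classical
  rw [spectralSubspace, iSup_subtype', Submodule.mem_iSup_iff_exists_dfinsupp'] at hu
  obtain ⟨f, rfl⟩ := hu
  have hV : OrthogonalFamily 𝕜 (fun i : s => eigenspace (T : End 𝕜 E) ((i : ℝ) : 𝕜))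
      fun i => (eigenspace (T : End 𝕜 E) ((i : ℝ) : 𝕜)).subtypeₗᵢ :=
    hT.orthogonalFamily_eigenspaces.comp
      (f := fun i : s => ((i : ℝ) : 𝕜)) fun i j h => Subtype.ext (RCLike.ofReal_injective h)
  refine ⟨f.support, fun i => ‖f i‖, fun i hi => ?_, hV.norm_sum (fun i => f i) f.support, ?_⟩
  · refine hasEigenvalue_of_hasEigenvector (x := (f i : E)) ⟨(f i).2, ?_⟩
    simpa using hi
  · have h := hV.norm_sum (fun i => (((i : ℝ) - a : ℝ) : 𝕜) • f i) f.support
    simp only [norm_smul, mul_pow, RCLike.norm_ofReal, sq_abs] at h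
    rw [← h, DFinsupp.sum, map_sum, Finset.smul_sum, ← Finset.sum_sub_distrib]
    congr 2
    refine Finset.sum_congr rfl fun i _ => ?_
    have : T (f i : E) = ((i : ℝ) : 𝕜) • (f i : E) := by
      simpa using mem_eigenspace_iff.1 (f i).2
    simp [this, sub_smul]

theorem norm_sub_smul_le_of_mem_spectralSubspace {T : E →L[𝕜] E} (hT : T.IsSymmetric)
    {s : Set ℝ} {a r : ℝ} (hr : 0 ≤ r)
    (h : ∀ ν ∈ s, HasEigenvalue (T : End 𝕜 E) (ν : 𝕜) → |ν - a| ≤ r) {u : E}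
    (hu : u ∈ spectralSubspace T s) : ‖T u - (a : 𝕜) • u‖ ≤ r * ‖u‖ := by
  obtain ⟨F, n, hF, h1, h2⟩ := exists_sum_of_mem_spectralSubspace hT hu a
  refine le_of_sq_le_sq ?_ (by positivity)
  rw [mul_pow, h1, h2, Finset.mul_sum]
  refine Finset.sum_le_sum fun i hi => mul_le_mul_of_nonneg_right ?_ (sq_nonneg _)
  exact sq_le_sq' (abs_le.1 (h i i.2 (hF i hi))).1 (abs_le.1 (h i i.2 (hF i hi))).2

theorem le_norm_sub_smul_of_mem_spectralSubspace {T : E →L[𝕜] E} (hT : T.IsSymmetric)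
    {s : Set ℝ} {a d : ℝ} (hd : 0 ≤ d)
    (h : ∀ ν ∈ s, HasEigenvalue (T : End 𝕜 E) (ν : 𝕜) → d ≤ |ν - a|) {u : E}
    (hu : u ∈ spectralSubspace T s) : d * ‖u‖ ≤ ‖T u - (a : 𝕜) • u‖ := by
  obtain ⟨F, n, hF, h1, h2⟩ := exists_sum_of_mem_spectralSubspace hT hu a
  refine le_of_sq_le_sq ?_ (by positivity)
  rw [mul_pow, h1, h2, Finset.mul_sum]
  refine Finset.sum_le_sum fun i hi => mul_le_mul_of_nonneg_right ?_ (sq_nonneg _)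
  rw [← sq_abs ((i : ℝ) - a)]
  exact pow_le_pow_left₀ hd (h i i.2 (hF i hi)) 2

theorem spectralSubspace_isOrtho_compl {T : E →L[𝕜] E} (hT : T.IsSymmetric) (s : Set ℝ) :
    spectralSubspace T s ⟂ spectralSubspace T sᶜ := by
  simp only [spectralSubspace, Submodule.isOrtho_iSup_left, Submodule.isOrtho_iSup_right]
  intro ν hν κ hκ
  refine hT.orthogonalFamily_eigenspaces.isOrtho ?_
  intro h
  obtain rfl := RCLike.ofReal_injective h
  exact hν hκ

theorem iSup_eigenspace_le_spectralSubspace_sup {T : E →L[𝕜] E} (hT : T.IsSymmetric)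
    (s : Set ℝ) : (⨆ μ, eigenspace (T : End 𝕜 E) μ) ≤
      spectralSubspace T s ⊔ spectralSubspace T sᶜ := by
  refine iSup_le fun μ => ?_
  by_cases he : eigenspace (T : End 𝕜 E) μ = ⊥
  · simp [he]
  have hμ : ((RCLike.re μ : ℝ) : 𝕜) = μ :=
    RCLike.conj_eq_iff_re.1 (hT.conj_eigenvalue_eq_self (hasEigenvalue_iff.2 he))
  rw [← hμ]
  by_cases hs : RCLike.re μ ∈ s
  · exact (eigenspace_le_spectralSubspace T hs).trans le_sup_left
  · exact (eigenspace_le_spectralSubspace T (s := sᶜ) hs).trans le_sup_right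

theorem orthogonal_map_mem {T : E →L[𝕜] E} (hT : T.IsSymmetric) (s : Set ℝ) {z : E}
    (hz : z ∈ (spectralSubspace T s)ᗮ) : T z ∈ (spectralSubspace T s)ᗮ := by
  intro w hw
  have h1 : inner 𝕜 (T w) z = inner 𝕜 w (T z) := hT w z
  rw [← h1]
  exact hz _ (map_mem_spectralSubspace T s hw)

/-- Two subspaces have equal finite dimension if neither contains a nonzero vector orthogonal to
the other. -/
theorem finrank_eq_of_orthogonal_disjoint (X W : Submodule 𝕜 E) [FiniteDimensional 𝕜 X]
    (h1 : ∀ w ∈ W, w ∈ Xᗮ → w = 0) (h2 : ∀ x ∈ X, x ∈ Wᗮ → x = 0) :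
    FiniteDimensional 𝕜 W ∧ Module.finrank 𝕜 W = Module.finrank 𝕜 X ∧
      ∀ w ∈ W, ∃ x ∈ X, x - w ∈ Wᗮ := by
  have inj : ∀ (Y Z : Submodule 𝕜 E) [Z.HasOrthogonalProjection],
      (∀ w ∈ Y, w ∈ Zᗮ → w = 0) →
      Function.Injective ((Z.orthogonalProjectionOnto : E →L[𝕜] Z).toLinearMap ∘ₗ Y.subtype) := by
    intro Y Z _ h
    rw [← LinearMap.ker_eq_bot, LinearMap.ker_eq_bot']
    intro w hw
    refine Subtype.ext (h w w.2 ?_)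
    rw [← Submodule.ker_orthogonalProjectionOnto]
    exact hw
  have i1 := inj W X h1
  -- Finite dimension of `W` comes first: the projection onto `W` needs it.
  have hW : FiniteDimensional 𝕜 W := FiniteDimensional.of_injective _ i1
  have i2 := inj X W h2
  have he : Module.finrank 𝕜 W = Module.finrank 𝕜 X :=
    le_antisymm (LinearMap.finrank_le_finrank_of_injective i1)
      (LinearMap.finrank_le_finrank_of_injective i2)
  refine ⟨hW, he, fun w hw => ?_⟩
  obtain ⟨x, hx⟩ :=
    (LinearMap.injective_iff_surjective_of_finrank_eq_finrank he.symm).1 i2 ⟨w, hw⟩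
  refine ⟨x, x.2, ?_⟩
  have hxw : W.starProjection x = w := congrArg Subtype.val hx
  rw [← hxw]
  exact W.sub_starProjection_mem_orthogonal _

variable [CompleteSpace E]

/-- What remains of `u` after projection to the closure is orthogonal to every eigenspace, hence
zero by the spectral theorem. -/
theorem mem_closure_spectralSubspace_compl {T : E →L[𝕜] E} (hc : IsCompactOperator T)
    (hT : T.IsSymmetric) {s : Set ℝ} {u : E} (hu : u ∈ (spectralSubspace T s)ᗮ) :
    u ∈ (spectralSubspace T sᶜ).topologicalClosure := by
  set V := (spectralSubspace T sᶜ).topologicalClosure with hV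
  have : CompleteSpace V := (Submodule.isClosed_topologicalClosure _).completeSpace_coe
  have hVs : V ≤ (spectralSubspace T s)ᗮ :=
    Submodule.topologicalClosure_minimal _ (spectralSubspace_isOrtho_compl hT s).symm
      (Submodule.isClosed_orthogonal _)
  have hq : u - V.starProjection u ∈ (⨆ μ, eigenspace (T : End 𝕜 E) μ)ᗮ := by
    refine Submodule.orthogonal_le (iSup_eigenspace_le_spectralSubspace_sup hT s) ?_
    rw [← Submodule.inf_orthogonal]
    refine ⟨Submodule.sub_mem _ hu (hVs (V.starProjection_apply_mem u)), ?_⟩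
    exact Submodule.orthogonal_le (Submodule.le_topologicalClosure _)
      (V.sub_starProjection_mem_orthogonal u)
  rw [ContinuousLinearMap.orthogonalComplement_iSup_eigenspaces_eq_bot hc hT,
    Submodule.mem_bot, sub_eq_zero] at hq
  rw [hq]
  exact V.starProjection_apply_mem u

/-- The inequality is a closed condition, so it passes from sums of eigenvectors to their closure.
-/
theorem le_norm_sub_smul_of_mem_orthogonal {T : E →L[𝕜] E} (hc : IsCompactOperator T)
    (hT : T.IsSymmetric) {s : Set ℝ} {a d : ℝ} (hd : 0 ≤ d)
    (h : ∀ ν ∉ s, HasEigenvalue (T : End 𝕜 E) (ν : 𝕜) → d ≤ |ν - a|) {u : E}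
    (hu : u ∈ (spectralSubspace T s)ᗮ) : d * ‖u‖ ≤ ‖T u - (a : 𝕜) • u‖ := by
  have hcl : IsClosed {u : E | d * ‖u‖ ≤ ‖T u - (a : 𝕜) • u‖} :=
    isClosed_le (by fun_prop) (by fun_prop)
  refine closure_minimal (fun v hv => ?_) hcl (mem_closure_spectralSubspace_compl hc hT hu)
  exact le_norm_sub_smul_of_mem_spectralSubspace hT hd h hv

end Spectral

/-! ### Perturbation of an isolated eigenvalue -/

section Perturbation

variable {𝕜 : Type*} [RCLike 𝕜] {E : Type*} [NormedAddCommGroup E] [InnerProductSpace 𝕜 E]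

theorem norm_map_sub_smul_le_of_mem_eigenspace {A B : E →L[𝕜] E} {a r : ℝ}
    (hr : ∀ u, ‖A u - B u‖ ≤ r * ‖u‖) {u : E} (hu : u ∈ eigenspace (A : End 𝕜 E) (a : 𝕜)) :
    ‖B u - (a : 𝕜) • u‖ ≤ r * ‖u‖ := by
  have hu' : A u = (a : 𝕜) • u := by simpa using mem_eigenspace_iff.1 hu
  rw [← hu', norm_sub_rev]
  exact hr u

variable [CompleteSpace E]

theorem le_of_hasEigenvalue_of_norm_sub_le {A B : E →L[𝕜] E} (hc : IsCompactOperator A)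
    (hA : A.IsSymmetric) {r d ν : ℝ} (hr : ∀ u, ‖A u - B u‖ ≤ r * ‖u‖) (hd : 0 ≤ d)
    (h : ∀ κ : ℝ, HasEigenvalue (A : End 𝕜 E) (κ : 𝕜) → d ≤ |κ - ν|)
    (hν : HasEigenvalue (B : End 𝕜 E) (ν : 𝕜)) : d ≤ r := by
  obtain ⟨u, hu, hu0⟩ := hν.exists_hasEigenvector
  have hu' : B u = (ν : 𝕜) • u := by simpa using mem_eigenspace_iff.1 hu
  have h1 : d * ‖u‖ ≤ ‖A u - (ν : 𝕜) • u‖ :=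
    -- With `s = ∅` the spectral subspace is zero, so the bound holds for every vector.
    le_norm_sub_smul_of_mem_orthogonal hc hA (s := ∅) hd (fun κ _ => h κ)
      (by simp [spectralSubspace])
  rw [← hu'] at h1
  exact le_of_mul_le_mul_right (h1.trans (hr u)) (norm_pos_iff.2 hu0)

/-- A unit `w ∈ W` orthogonal to `X` would satisfy `g ≤ ‖(A - a)w‖ ≤ r + r`, and a unit `x ∈ X`
orthogonal to `W` would satisfy `d ≤ ‖(B - a)x‖ ≤ r`. -/
theorem finrank_spectralSubspace_eq {A B : E →L[𝕜] E} (hcA : IsCompactOperator A)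
    (hA : A.IsSymmetric) (hcB : IsCompactOperator B) (hB : B.IsSymmetric) {a r d g : ℝ}
    (ha : a ≠ 0) (hr0 : 0 ≤ r) (hr : ∀ u, ‖A u - B u‖ ≤ r * ‖u‖) (hrd : r < d)
    (hrg : r + r < g) {s : Set ℝ}
    (h1 : ∀ κ : ℝ, κ ≠ a → HasEigenvalue (A : End 𝕜 E) (κ : 𝕜) → g ≤ |κ - a|)
    (h2 : ∀ ν ∈ s, HasEigenvalue (B : End 𝕜 E) (ν : 𝕜) → |ν - a| ≤ r)
    (h3 : ∀ ν ∉ s, HasEigenvalue (B : End 𝕜 E) (ν : 𝕜) → d ≤ |ν - a|) :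
    finrank 𝕜 (spectralSubspace B s) = finrank 𝕜 (eigenspace (A : End 𝕜 E) (a : 𝕜)) ∧
      ∀ w ∈ spectralSubspace B s, ∃ x ∈ eigenspace (A : End 𝕜 E) (a : 𝕜),
        x - w ∈ (spectralSubspace B s)ᗮ := by
  have hfd : FiniteDimensional 𝕜 (eigenspace (A : End 𝕜 E) (a : 𝕜)) :=
    ContinuousLinearMap.finite_dimensional_eigenspace hcA _ (by exact_mod_cast ha)
  refine (finrank_eq_of_orthogonal_disjoint _ _ (fun w hw hwX => ?_) fun x hx hxW => ?_).2
  · by_contra hw0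
    have hw0 := norm_pos_iff.2 hw0
    rw [← spectralSubspace_singleton] at hwX
    have e1 : g * ‖w‖ ≤ ‖A w - (a : 𝕜) • w‖ :=
      le_norm_sub_smul_of_mem_orthogonal hcA hA (by linarith) h1 hwX
    have e2 := norm_sub_smul_le_of_mem_spectralSubspace hB hr0 h2 hw
    have e3 := norm_sub_le_norm_sub_add_norm_sub (A w) (B w) ((a : 𝕜) • w)
    have e4 := hr w
    nlinarith
  · by_contra hx0
    have hx0 := norm_pos_iff.2 hx0
    have e1 := le_norm_sub_smul_of_mem_orthogonal hcB hB (by linarith) h3 hxW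
    have e2 := norm_map_sub_smul_le_of_mem_eigenspace hr hx
    nlinarith

/-- The quadratic estimate for the perturbation of an eigenvalue: the error is controlled by the
quadratic form and by the square of the residual. -/
theorem abs_eigenvalue_sub_le {B : E →L[𝕜] E} (hc : IsCompactOperator B) (hB : B.IsSymmetric)
    {a d ν Q R : ℝ} (hd : 0 < d) {s : Set ℝ}
    (h3 : ∀ κ ∉ s, HasEigenvalue (B : End 𝕜 E) (κ : 𝕜) → d ≤ |κ - a|) {w φ : E}
    (hw : w ∈ spectralSubspace B s) (hw0 : w ≠ 0) (hwν : B w = (ν : 𝕜) • w)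
    (hφ : φ - w ∈ (spectralSubspace B s)ᗮ)
    (hres : ‖B φ - (a : 𝕜) • φ‖ ≤ d / 2 * ‖φ‖)
    (hR : ‖B φ - (a : 𝕜) • φ‖ ^ 2 ≤ R * ‖φ‖ ^ 2)
    (hQ : ‖(inner 𝕜 (B φ - (a : 𝕜) • φ) φ : 𝕜)‖ ≤ Q * ‖φ‖ ^ 2) :
    |ν - a| ≤ 4 * (Q + R / d) := by
  obtain ⟨z, rfl⟩ : ∃ z, φ = w + z := ⟨φ - w, by abel⟩
  rw [add_sub_cancel_left] at hφ
  have hwz : inner 𝕜 w z = 0 := hφ w hw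
  have hzw : inner 𝕜 z w = 0 := inner_eq_zero_symm.1 hwz
  set Nz := B z - (a : 𝕜) • z with hNz
  have hNzm : Nz ∈ (spectralSubspace B s)ᗮ :=
    Submodule.sub_mem _ (orthogonal_map_mem hB s hφ) (Submodule.smul_mem _ _ hφ)
  have hwN : inner 𝕜 w Nz = 0 := hNzm w hw
  have hNw : inner 𝕜 Nz w = 0 := inner_eq_zero_symm.1 hwN
  have hN : B (w + z) - (a : 𝕜) • (w + z) = ((ν - a : ℝ) : 𝕜) • w + Nz := by
    rw [hNz, map_add, hwν]
    push_cast
    module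
  rw [hN] at hres hR hQ
  have hdz : d * ‖z‖ ≤ ‖Nz‖ := le_norm_sub_smul_of_mem_orthogonal hc hB hd.le h3 hφ
  have p1 : ‖w + z‖ ^ 2 = ‖w‖ ^ 2 + ‖z‖ ^ 2 := by
    simpa [sq] using norm_add_sq_eq_norm_sq_add_norm_sq_of_inner_eq_zero w z hwz
  have p2 : ‖((ν - a : ℝ) : 𝕜) • w + Nz‖ ^ 2 = ‖((ν - a : ℝ) : 𝕜) • w‖ ^ 2 + ‖Nz‖ ^ 2 := by
    simpa [sq] using norm_add_sq_eq_norm_sq_add_norm_sq_of_inner_eq_zero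
      (((ν - a : ℝ) : 𝕜) • w) Nz (by rw [inner_smul_left, hwN, mul_zero])
  have hNφ : ‖Nz‖ ^ 2 ≤ R * ‖w + z‖ ^ 2 := by
    rw [p2] at hR
    nlinarith [sq_nonneg ‖((ν - a : ℝ) : 𝕜) • w‖]
  -- The residual bound `d / 2` keeps `z` small, so `‖w‖² ≥ (3/4)‖φ‖²`; the final factor `4` is
  -- generous.
  have hz : ‖z‖ ^ 2 ≤ 1 / 4 * ‖w + z‖ ^ 2 := by
    have h1 : ‖Nz‖ ≤ d / 2 * ‖w + z‖ := by
      refine le_trans (le_of_sq_le_sq ?_ (norm_nonneg _)) hres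
      rw [p2]
      nlinarith [sq_nonneg ‖((ν - a : ℝ) : 𝕜) • w‖]
    have h2 : ‖z‖ ≤ 1 / 2 * ‖w + z‖ := by
      refine le_of_mul_le_mul_left ?_ hd
      linarith
    calc ‖z‖ ^ 2 ≤ (1 / 2 * ‖w + z‖) ^ 2 := pow_le_pow_left₀ (norm_nonneg _) h2 2
      _ = _ := by ring
  -- `B` preserves the complement of `W`, so the cross terms vanish.
  have hin : inner 𝕜 (((ν - a : ℝ) : 𝕜) • w + Nz) (w + z)
      = (((ν - a) * ‖w‖ ^ 2 : ℝ) : 𝕜) + inner 𝕜 Nz z := by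
    rw [inner_add_left, inner_add_right, inner_add_right, hNw, inner_smul_left, inner_smul_left,
      hwz, inner_self_eq_norm_sq_to_K, RCLike.conj_ofReal]
    push_cast
    ring
  have hQz : ‖(inner 𝕜 Nz z : 𝕜)‖ ≤ R / d * ‖w + z‖ ^ 2 := by
    refine (norm_inner_le_norm _ _).trans ?_
    rw [div_mul_eq_mul_div, le_div_iff₀ hd]
    calc ‖Nz‖ * ‖z‖ * d = ‖Nz‖ * (d * ‖z‖) := by ring
      _ ≤ ‖Nz‖ * ‖Nz‖ := by gcongr
      _ ≤ R * ‖w + z‖ ^ 2 := by rw [← sq]; exact hNφ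
  have hkey : |ν - a| * ‖w‖ ^ 2 ≤ (Q + R / d) * ‖w + z‖ ^ 2 := by
    have h1 : |ν - a| * ‖w‖ ^ 2 = ‖(((ν - a) * ‖w‖ ^ 2 : ℝ) : 𝕜)‖ := by
      rw [RCLike.norm_ofReal, abs_mul, abs_of_nonneg (sq_nonneg ‖w‖)]
    rw [h1, show ((((ν - a) * ‖w‖ ^ 2 : ℝ) : 𝕜))
      = inner 𝕜 (((ν - a : ℝ) : 𝕜) • w + Nz) (w + z) - inner 𝕜 Nz z by rw [hin]; ring]
    refine (norm_sub_le _ _).trans ?_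
    linarith
  have hw0 : 0 < ‖w‖ ^ 2 := by positivity
  -- The sign is needed to replace `‖w + z‖²` by a multiple of `‖w‖²`.
  have hnn : 0 ≤ Q + R / d := by
    by_contra! hneg
    have : 0 ≤ |ν - a| * ‖w‖ ^ 2 := by positivity
    nlinarith [sq_nonneg ‖z‖]
  refine le_of_mul_le_mul_right ?_ hw0
  nlinarith [sq_nonneg ‖z‖]

end Perturbation

variable {𝕜 : Type*} [RCLike 𝕜]
  {H : Type*} [NormedAddCommGroup H] [InnerProductSpace 𝕜 H] [CompleteSpace H]
  {HH : Type*} [NormedAddCommGroup HH] [InnerProductSpace 𝕜 HH] [CompleteSpace HH]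

/-! ### Orthogonal projectors -/

section Projections

theorem proj_mem (V : ClosedSubmodule 𝕜 H) (u : H) : proj V u ∈ V.toSubmodule :=
  V.toSubmodule.starProjection_apply_mem u

theorem proj_eq_self {V : ClosedSubmodule 𝕜 H} {u : H} (hu : u ∈ V.toSubmodule) :
    proj V u = u :=
  Submodule.starProjection_eq_self_iff.2 hu

theorem coproj_apply (V : ClosedSubmodule 𝕜 H) (u : H) : coproj V u = u - proj V u := rfl

theorem inner_proj_left (V : ClosedSubmodule 𝕜 H) (u v : H) :
    inner 𝕜 (proj V u) v = inner 𝕜 u (proj V v) :=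
  V.toSubmodule.inner_starProjection_left_eq_right u v

theorem norm_proj_le (V : ClosedSubmodule 𝕜 H) (u : H) : ‖proj V u‖ ≤ ‖u‖ :=
  V.toSubmodule.norm_starProjection_apply_le u

theorem adjoint_proj (V : ClosedSubmodule 𝕜 H) : (proj V).adjoint = proj V := by
  refine ((ContinuousLinearMap.eq_adjoint_iff _ _).2 fun u v => ?_).symm
  exact inner_proj_left V u v

theorem inner_proj_self (V : ClosedSubmodule 𝕜 H) (u : H) :
    inner 𝕜 (proj V u) u = inner 𝕜 (proj V u) (proj V u) := by
  rw [inner_proj_left V u (proj V u), proj_eq_self (proj_mem V u), inner_proj_left]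

theorem inner_self_proj (V : ClosedSubmodule 𝕜 H) (u : H) :
    inner 𝕜 u (proj V u) = inner 𝕜 (proj V u) (proj V u) := by
  rw [← inner_proj_left, inner_proj_self]

theorem inner_self_eq_proj_add_coproj (V : ClosedSubmodule 𝕜 H) (u : H) :
    (inner 𝕜 u u : 𝕜) = inner 𝕜 (proj V u) (proj V u) + inner 𝕜 (coproj V u) (coproj V u) := by
  rw [coproj_apply, inner_sub_sub_self, inner_proj_self, inner_self_proj]
  ring

theorem norm_coproj_le (V : ClosedSubmodule 𝕜 H) (u : H) : ‖coproj V u‖ ≤ ‖u‖ := by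
  have h := congrArg RCLike.re (inner_self_eq_proj_add_coproj V u)
  rw [map_add, inner_self_eq_norm_sq, inner_self_eq_norm_sq, inner_self_eq_norm_sq] at h
  exact le_of_sq_le_sq (by nlinarith [sq_nonneg ‖proj V u‖]) (norm_nonneg _)

/-- The projector onto `V ⊓ W` has its range in `W`, so it is killed by the complementary operator
of `W`. -/
theorem norm_coproj_le_norm_coproj_inf (V W : ClosedSubmodule 𝕜 H) (u : H) :
    ‖coproj W u‖ ≤ ‖coproj (V ⊓ W) u‖ := by
  have hm : proj (V ⊓ W) u ∈ W.toSubmodule :=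
    (inf_le_right : V ⊓ W ≤ W) (proj_mem (V ⊓ W) u)
  have h : coproj W u = coproj W (coproj (V ⊓ W) u) := by
    simp only [coproj_apply, map_sub, proj_eq_self hm]
    abel
  rw [h]
  exact norm_coproj_le _ _

end Projections

/-! ### Both operators extended to the whole space -/

section AmbientOperator

/-- The extension by zero of the operator `K : V → V` to all of `H`. -/
def ambientOp (ι : H →L[𝕜] HH) (V : ClosedSubmodule 𝕜 H) : H →L[𝕜] H :=
  (ι ∘L proj V).adjoint ∘L (ι ∘L proj V)

variable (ι : H →L[𝕜] HH) (V : ClosedSubmodule 𝕜 H)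

theorem ambientOp_apply (u : H) :
    ambientOp ι V u = proj V (ι.adjoint (ι (proj V u))) := by
  simp [ambientOp, ContinuousLinearMap.adjoint_comp, adjoint_proj]

theorem inner_ambientOp (u v : H) :
    inner 𝕜 (ambientOp ι V u) v = inner 𝕜 (ι (proj V u)) (ι (proj V v)) := by
  simp [ambientOp, ContinuousLinearMap.adjoint_inner_left]

theorem ambientOp_isSymmetric : (ambientOp ι V).IsSymmetric := fun u v => by
  change inner 𝕜 (ambientOp ι V u) v = inner 𝕜 u (ambientOp ι V v)
  rw [inner_ambientOp, ← inner_conj_symm u, inner_ambientOp, inner_conj_symm]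

variable {ι} in
theorem isCompactOperator_ambientOp (h : IsCompactOperator ι) :
    IsCompactOperator (ambientOp ι V) :=
  (h.comp_clm (proj V)).clm_comp (ι ∘L proj V).adjoint

theorem adjoint_incl_apply (x : HH) : ((incl ι V).adjoint x : H) = proj V (ι.adjoint x) := by
  simp [incl, ContinuousLinearMap.adjoint_comp, proj, Submodule.adjoint_subtypeL]

theorem coe_opK (u : V.toSubmodule) : (opK ι V u : H) = ambientOp ι V u := by
  rw [ambientOp_apply, proj_eq_self u.2]
  exact adjoint_incl_apply ι V _

theorem mem_eigSp_iff (ν : ℝ) (u : V.toSubmodule) :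
    u ∈ eigSp ι V ν ↔ ambientOp ι V u = (ν : 𝕜) • (u : H) := by
  rw [eigSp, mem_eigenspace_iff, ← coe_opK, ← Submodule.coe_smul, ← Subtype.ext_iff]
  rfl

/-- An eigenvector for `ν ≠ 0` lies in the range of the extension, hence in `V`. At zero this fails:
the extension also annihilates `Vᗮ`. -/
theorem map_eigSp {ν : ℝ} (hν : ν ≠ 0) :
    (eigSp ι V ν).map V.toSubmodule.subtype = eigenspace (ambientOp ι V : End 𝕜 H) (ν : 𝕜) := by
  ext u
  rw [Submodule.mem_map, mem_eigenspace_iff]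
  constructor
  · rintro ⟨v, hv, rfl⟩
    exact (mem_eigSp_iff ι V ν v).1 hv
  · intro hu
    have hu' : ambientOp ι V u = (ν : 𝕜) • u := hu
    have hmem : u ∈ V.toSubmodule := by
      have h1 : (ν : 𝕜) • u ∈ V.toSubmodule := by
        rw [← hu', ambientOp_apply]
        exact proj_mem V _
      exact (Submodule.smul_mem_iff _ (by exact_mod_cast hν)).1 h1
    exact ⟨⟨u, hmem⟩, (mem_eigSp_iff ι V ν _).2 hu', rfl⟩

theorem finrank_eigSp {ν : ℝ} (hν : ν ≠ 0) :
    finrank 𝕜 (eigSp ι V ν) = finrank 𝕜 (eigenspace (ambientOp ι V : End 𝕜 H) (ν : 𝕜)) := by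
  rw [← map_eigSp ι V hν]
  exact (Submodule.finrank_map_subtype_eq _ _).symm

theorem eigCount_eq {s : Set ℝ} (hs : (0 : ℝ) ∉ s) :
    eigCount ι V s = finrank 𝕜 (spectralSubspace (ambientOp ι V) s) := by
  have h : spectralSubspace (ambientOp ι V) s
      = (⨆ ν ∈ s, eigSp ι V ν : Submodule 𝕜 V.toSubmodule).map V.toSubmodule.subtype := by
    simp only [spectralSubspace, Submodule.map_iSup]
    refine iSup_congr fun ν => iSup_congr fun hν => (map_eigSp ι V ?_).symm
    rintro rfl
    exact hs hν
  rw [h]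
  exact (Submodule.finrank_map_subtype_eq _ _).symm

theorem isEig_iff_hasEigenvalue {ν : ℝ} (hν : ν ≠ 0) :
    IsEig ι V ν ↔ HasEigenvalue (ambientOp ι V : End 𝕜 H) (ν : 𝕜) := by
  rw [hasEigenvalue_iff, ← map_eigSp ι V hν, IsEig, hasEigenvalue_iff, ← eigSp]
  exact ((Submodule.map_injective_of_injective V.toSubmodule.subtype_injective).ne_iff'
    (Submodule.map_bot _)).symm

variable {ι} in
-- With `P = ι S_V` and `Q = ι S_W`, use `P*P - Q*Q = P*(P - Q) + (P - Q)*Q`.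
theorem norm_ambientOp_sub_le (V W : ClosedSubmodule 𝕜 H) {c₀ s : ℝ} (hc : 0 ≤ c₀)
    (hι : ∀ u, ‖ι u‖ ≤ c₀ * ‖u‖) (h : ∀ u, ‖ι (proj V u - proj W u)‖ ≤ s * ‖u‖) (u : H) :
    ‖ambientOp ι V u - ambientOp ι W u‖ ≤ 2 * c₀ * s * ‖u‖ := by
  by_cases hs : 0 ≤ s
  swap
  -- A negative `s` forces `u = 0`.
  · have h0 : ‖u‖ = 0 := by
      have := norm_nonneg (ι (proj V u - proj W u))
      nlinarith [h u, norm_nonneg u]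
    simp [norm_eq_zero.1 h0]
  have hA : ∀ X : ClosedSubmodule 𝕜 H, ‖ι ∘L proj X‖ ≤ c₀ := fun X =>
    ContinuousLinearMap.opNorm_le_bound _ hc fun v =>
      (hι _).trans (mul_le_mul_of_nonneg_left (norm_proj_le X v) hc)
  have hd : ‖ι ∘L proj V - ι ∘L proj W‖ ≤ s :=
    ContinuousLinearMap.opNorm_le_bound _ hs fun v => by simpa using h v
  have e : ambientOp ι V - ambientOp ι W
      = (ι ∘L proj V).adjoint ∘L (ι ∘L proj V - ι ∘L proj W)
        + (ι ∘L proj V - ι ∘L proj W).adjoint ∘L (ι ∘L proj W) := by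
    ext v
    simp [ambientOp]
  have hn : ‖ambientOp ι V - ambientOp ι W‖ ≤ 2 * c₀ * s := by
    rw [e]
    refine (norm_add_le _ _).trans ?_
    have h1 : ‖(ι ∘L proj V).adjoint ∘L (ι ∘L proj V - ι ∘L proj W)‖ ≤ c₀ * s := by
      refine (ContinuousLinearMap.opNorm_comp_le _ _).trans ?_
      rw [LinearIsometryEquiv.norm_map]
      exact mul_le_mul (hA V) hd (norm_nonneg _) hc
    have h2 : ‖(ι ∘L proj V - ι ∘L proj W).adjoint ∘L (ι ∘L proj W)‖ ≤ s * c₀ := by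
      refine (ContinuousLinearMap.opNorm_comp_le _ _).trans ?_
      rw [LinearIsometryEquiv.norm_map]
      exact mul_le_mul hd (hA W) (norm_nonneg _) hs
    linarith
  exact (ambientOp ι V - ambientOp ι W).le_of_opNorm_le hn u

end AmbientOperator

/-! ### The vector `Ψ_φ` and second-order estimates -/

section Psi

variable (ι : H →L[𝕜] HH) (V W : ClosedSubmodule 𝕜 H)

theorem coe_psi (l : ℝ) (φ : H) :
    (psi ι V l φ : H) = proj V φ - (l : 𝕜) • proj V (ι.adjoint (ι φ)) := by
  rw [psi, Submodule.coe_sub, Submodule.coe_smul, adjoint_incl_apply]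
  rfl

theorem continuous_psi (l : ℝ) : Continuous fun φ : H => psi ι V l φ := by
  unfold psi
  fun_prop

theorem psi_smul (l : ℝ) (c : 𝕜) (φ : H) : psi ι V l (c • φ) = c • psi ι V l φ := by
  simp only [psi, map_smul, smul_sub, smul_comm c]

theorem inner_psi_proj (l : ℝ) (φ χ : H) :
    inner 𝕜 (psi ι V l φ : H) (proj V χ) = inner 𝕜 (psi ι V l φ : H) χ := by
  rw [← inner_proj_left, proj_eq_self (psi ι V l φ).2]

/-- The squared size of the perturbation at the vector `φ`. -/
def defect (l : ℝ) (φ : H) : ℝ := ‖coproj (V ⊓ W) φ‖ ^ 2 + ‖psi ι W l φ‖ ^ 2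

theorem defect_smul (l : ℝ) (c : 𝕜) (φ : H) :
    defect ι V W l (c • φ) = ‖c‖ ^ 2 * defect ι V W l φ := by
  simp only [defect, psi_smul, map_smul, norm_smul]
  ring

theorem rhoSet_eq_image (l : ℝ) :
    rhoSet ι V W l = (fun φ : eigSp ι V l⁻¹ => defect ι V W l ((φ : V.toSubmodule) : H)) ''
      Metric.sphere 0 1 := by
  ext r
  constructor
  · rintro ⟨φ, hφ, h1, rfl⟩
    exact ⟨⟨φ, hφ⟩, by simpa using h1, rfl⟩
  · rintro ⟨φ, h1, rfl⟩
    exact ⟨φ, φ.2, by simpa using h1, rfl⟩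

variable {ι V W} {l : ℝ}

/-- The unit sphere of the finite-dimensional, nonzero eigenspace is compact and nonempty. -/
theorem isGreatest_rhoZero [FiniteDimensional 𝕜 (eigSp ι V l⁻¹)] (h : IsEig ι V l⁻¹) :
    IsGreatest (rhoSet ι V W l) (rhoZero ι V W l) := by
  have hcont : Continuous
      fun φ : eigSp ι V l⁻¹ => defect ι V W l ((φ : V.toSubmodule) : H) := by
    have := continuous_psi ι W l
    unfold defect
    fun_prop
  have : ProperSpace (eigSp ι V l⁻¹) := FiniteDimensional.proper_rclike 𝕜 _
  have hnt : Nontrivial (eigSp ι V l⁻¹) :=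
    Submodule.nontrivial_iff_ne_bot.2 (hasEigenvalue_iff.1 h)
  have hcpt : IsCompact (rhoSet ι V W l) := by
    rw [rhoSet_eq_image]
    exact (isCompact_sphere _ _).image hcont
  refine hcpt.isGreatest_sSup ?_
  rw [rhoSet_eq_image]
  refine Set.Nonempty.image _ ?_
  obtain ⟨x, hx⟩ := exists_ne (0 : eigSp ι V l⁻¹)
  exact ⟨((‖x‖⁻¹ : ℝ) : 𝕜) • x, by simp [norm_smul, hx]⟩

theorem defect_le (hg : IsGreatest (rhoSet ι V W l) (rhoZero ι V W l)) {φ : V.toSubmodule}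
    (hφ : φ ∈ eigSp ι V l⁻¹) : defect ι V W l φ ≤ rhoZero ι V W l * ‖φ‖ ^ 2 := by
  by_cases h0 : φ = 0
  · simp [h0, defect, psi]
  have hn : 0 < ‖φ‖ := norm_pos_iff.2 h0
  have h1 := hg.2 ⟨((‖φ‖⁻¹ : ℝ) : 𝕜) • φ, Submodule.smul_mem _ _ hφ, by
    rw [norm_smul, RCLike.norm_ofReal, abs_of_pos (inv_pos.2 hn), inv_mul_cancel₀ hn.ne'], rfl⟩
  have h2 := defect_smul ι V W l ((‖φ‖⁻¹ : ℝ) : 𝕜) (φ : H)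
  rw [RCLike.norm_ofReal, sq_abs, inv_pow] at h2
  have h3 : (‖φ‖ ^ 2)⁻¹ * defect ι V W l φ ≤ rhoZero ι V W l := by
    rw [← h2]
    exact h1
  rwa [inv_mul_le_iff₀ (by positivity), mul_comm] at h3

/-- For `w ∈ V ⊓ W` the eigenvalue equation says `(φ, w) = l ⟨φ, w⟩`, so `Ψ_φ` is orthogonal to `V ⊓
W`. -/
theorem inner_psi_eq_coproj (hl : l ≠ 0) {φ : V.toSubmodule} (hφ : φ ∈ eigSp ι V l⁻¹) (χ : H) :
    inner 𝕜 (psi ι W l (φ : H) : H) χ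
      = inner 𝕜 (psi ι W l (φ : H) : H) (coproj (V ⊓ W) χ) := by
  have hV : proj (V ⊓ W) χ ∈ V.toSubmodule :=
    (inf_le_left : V ⊓ W ≤ V) (proj_mem (V ⊓ W) χ)
  have hW : proj (V ⊓ W) χ ∈ W.toSubmodule :=
    (inf_le_right : V ⊓ W ≤ W) (proj_mem (V ⊓ W) χ)
  have h1 := inner_psi ι W l (φ : H) ⟨_, hW⟩
  have h2 := inner_ambientOp ι V (φ : H) (proj (V ⊓ W) χ)
  rw [(mem_eigSp_iff ι V _ φ).1 hφ, inner_smul_left, proj_eq_self φ.2, proj_eq_self hV,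
    RCLike.conj_ofReal] at h2
  have hl' : (l : 𝕜) ≠ 0 := by exact_mod_cast hl
  rw [← h2] at h1
  push_cast at h1
  rw [mul_inv_cancel_left₀ hl', sub_self] at h1
  rw [coproj_apply, inner_sub_right, h1, sub_zero]

theorem norm_inner_psi_le (hl : l ≠ 0) {φ : V.toSubmodule} (hφ : φ ∈ eigSp ι V l⁻¹) :
    2 * ‖(inner 𝕜 (psi ι W l (φ : H) : H) (φ : H) : 𝕜)‖ ≤ defect ι V W l φ := by
  rw [inner_psi_eq_coproj hl hφ]
  have h1 := norm_inner_le_norm (𝕜 := 𝕜) (psi ι W l (φ : H) : H) (coproj (V ⊓ W) (φ : H))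
  rw [← Submodule.coe_norm] at h1
  unfold defect
  linarith [two_mul_le_add_sq ‖psi ι W l (φ : H)‖ ‖coproj (V ⊓ W) (φ : H)‖]

theorem ambientOp_sub_smul (hl : l ≠ 0) (φ : H) :
    ambientOp ι W φ - ((l⁻¹ : ℝ) : 𝕜) • φ
      = -(((l⁻¹ : ℝ) : 𝕜) • (psi ι W l φ : H)) - proj W (ι.adjoint (ι (coproj W φ)))
        - ((l⁻¹ : ℝ) : 𝕜) • coproj W φ := by
  have hl' : (l : 𝕜) ≠ 0 := by exact_mod_cast hl
  rw [coe_psi, ambientOp_apply, smul_sub, smul_smul]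
  push_cast
  rw [inv_mul_cancel₀ hl', one_smul]
  simp only [coproj_apply, map_sub, smul_sub]
  abel

/-- Expand `|T₂φ|²` and eliminate the mixed terms: `Ψ_φ` tested with `S₂φ` gives `⟨φ, S₂φ⟩`, and the
eigenvalue equation gives `⟨φ, φ⟩`. -/
theorem inner_ambientOp_sub_smul (hl : l ≠ 0) {φ : V.toSubmodule} (hφ : φ ∈ eigSp ι V l⁻¹) :
    inner 𝕜 (ambientOp ι W (φ : H) - ((l⁻¹ : ℝ) : 𝕜) • (φ : H)) (φ : H)
      = inner 𝕜 (ι (coproj W (φ : H))) (ι (coproj W (φ : H)))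
        - ((l⁻¹ : ℝ) : 𝕜) * (inner 𝕜 (psi ι W l (φ : H) : H) (φ : H)
          + inner 𝕜 (φ : H) (psi ι W l (φ : H) : H)
          + 2 * inner 𝕜 (coproj W (φ : H)) (coproj W (φ : H))) := by
  have hl' : (l : 𝕜) ≠ 0 := by exact_mod_cast hl
  have e1 := inner_psi ι W l (φ : H) ⟨_, proj_mem W (φ : H)⟩
  have e2 := congrArg (starRingEnd 𝕜) e1
  simp only [map_sub, map_mul, inner_conj_symm, RCLike.conj_ofReal] at e2
  rw [inner_psi_proj] at e1
  rw [inner_proj_left, proj_eq_self (psi ι W l (φ : H)).2, inner_proj_self] at e2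
  rw [inner_self_proj] at e1
  have e3 := inner_ambientOp ι V (φ : H) (φ : H)
  rw [(mem_eigSp_iff ι V _ φ).1 hφ, inner_smul_left, proj_eq_self φ.2, RCLike.conj_ofReal] at e3
  have e4 := inner_self_eq_proj_add_coproj W (φ : H)
  rw [inner_sub_left, inner_smul_left, inner_ambientOp, RCLike.conj_ofReal, e1, e2]
  have e5 : (inner 𝕜 (ι (coproj W (φ : H))) (ι (coproj W (φ : H))) : 𝕜)
      = inner 𝕜 (ι (φ : H)) (ι (φ : H)) - inner 𝕜 (ι (φ : H)) (ι (proj W (φ : H)))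
        - inner 𝕜 (ι (proj W (φ : H))) (ι (φ : H))
        + inner 𝕜 (ι (proj W (φ : H))) (ι (proj W (φ : H))) := by
    rw [coproj_apply, map_sub, inner_sub_sub_self]
  rw [e5, ← e3, e4]
  push_cast
  field_simp
  ring

variable {c₀ : ℝ}

theorem norm_inner_ambientOp_sub_smul_le (hl : 0 < l) (hι : ∀ u, ‖ι u‖ ≤ c₀ * ‖u‖)
    {φ : V.toSubmodule} (hφ : φ ∈ eigSp ι V l⁻¹) :
    ‖(inner 𝕜 (ambientOp ι W (φ : H) - ((l⁻¹ : ℝ) : 𝕜) • (φ : H)) (φ : H) : 𝕜)‖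
      ≤ (3 * l⁻¹ + c₀ ^ 2) * defect ι V W l φ := by
  rw [inner_ambientOp_sub_smul hl.ne' hφ]
  have h1 := norm_inner_psi_le (W := W) hl.ne' hφ
  have h2 : ‖coproj W (φ : H)‖ ^ 2 ≤ defect ι V W l φ := by
    have := pow_le_pow_left₀ (norm_nonneg _) (norm_coproj_le_norm_coproj_inf V W (φ : H)) 2
    unfold defect
    nlinarith [sq_nonneg ‖psi ι W l (φ : H)‖]
  have h3 : ‖ι (coproj W (φ : H))‖ ^ 2 ≤ c₀ ^ 2 * defect ι V W l φ := by
    have := pow_le_pow_left₀ (norm_nonneg _) (hι (coproj W (φ : H))) 2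
    rw [mul_pow] at this
    exact this.trans (mul_le_mul_of_nonneg_left h2 (sq_nonneg _))
  have h4 : ‖(inner 𝕜 (φ : H) (psi ι W l (φ : H) : H) : 𝕜)‖
      = ‖(inner 𝕜 (psi ι W l (φ : H) : H) (φ : H) : 𝕜)‖ := norm_inner_symm _ _
  have hli : 0 < l⁻¹ := inv_pos.2 hl
  refine (norm_sub_le _ _).trans ?_
  rw [norm_mul, RCLike.norm_ofReal, abs_of_pos hli]
  have h5 : ‖(inner 𝕜 (psi ι W l (φ : H) : H) (φ : H)
          + inner 𝕜 (φ : H) (psi ι W l (φ : H) : H)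
          + 2 * inner 𝕜 (coproj W (φ : H)) (coproj W (φ : H)) : 𝕜)‖
        ≤ 3 * defect ι V W l φ := by
    refine norm_add₃_le.trans ?_
    rw [h4, norm_mul, RCLike.norm_ofNat, inner_self_eq_norm_sq_to_K, norm_pow,
      RCLike.norm_ofReal, sq_abs]
    linarith
  rw [inner_self_eq_norm_sq_to_K, norm_pow, RCLike.norm_ofReal, sq_abs]
  nlinarith [mul_le_mul_of_nonneg_left h5 hli.le]

theorem sq_norm_ambientOp_sub_smul_le (hl : 0 < l) (hc : 0 ≤ c₀) (hι : ∀ u, ‖ι u‖ ≤ c₀ * ‖u‖)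
    (φ : H) :
    ‖ambientOp ι W φ - ((l⁻¹ : ℝ) : 𝕜) • φ‖ ^ 2
      ≤ 2 * (l⁻¹ + c₀ ^ 2) ^ 2 * defect ι V W l φ := by
  have hli : 0 < l⁻¹ := inv_pos.2 hl
  have hιn : ‖ι‖ ≤ c₀ := ι.opNorm_le_bound hc hι
  have h0 : ‖proj W (ι.adjoint (ι (coproj W φ)))‖ ≤ c₀ ^ 2 * ‖coproj W φ‖ := by
    refine (norm_proj_le _ _).trans ?_
    have h1 : ‖ι.adjoint (ι (coproj W φ))‖ ≤ ‖ι.adjoint‖ * ‖ι (coproj W φ)‖ :=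
      ι.adjoint.le_opNorm _
    rw [LinearIsometryEquiv.norm_map] at h1
    calc _ ≤ ‖ι‖ * ‖ι (coproj W φ)‖ := h1
      _ ≤ c₀ * (c₀ * ‖coproj W φ‖) :=
        mul_le_mul hιn (hι _) (norm_nonneg _) hc
      _ = _ := by ring
  have hT := norm_coproj_le_norm_coproj_inf V W φ
  have h1 : ‖ambientOp ι W φ - ((l⁻¹ : ℝ) : 𝕜) • φ‖
      ≤ (l⁻¹ + c₀ ^ 2) * (‖coproj (V ⊓ W) φ‖ + ‖psi ι W l φ‖) := by
    rw [ambientOp_sub_smul hl.ne']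
    refine (norm_sub_le _ _).trans ?_
    have h2 := norm_sub_le (-(((l⁻¹ : ℝ) : 𝕜) • (psi ι W l φ : H)))
      (proj W (ι.adjoint (ι (coproj W φ))))
    rw [norm_neg] at h2
    simp only [norm_smul, RCLike.norm_ofReal, abs_of_pos hli, ← Submodule.coe_norm] at h2 ⊢
    have h3 : l⁻¹ * ‖coproj W φ‖ ≤ l⁻¹ * ‖coproj (V ⊓ W) φ‖ := by gcongr
    have h4 : c₀ ^ 2 * ‖coproj W φ‖ ≤ c₀ ^ 2 * ‖coproj (V ⊓ W) φ‖ := by gcongr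
    have h5 : 0 ≤ c₀ ^ 2 * ‖psi ι W l φ‖ := by positivity
    linarith
  calc _ ≤ ((l⁻¹ + c₀ ^ 2) * (‖coproj (V ⊓ W) φ‖ + ‖psi ι W l φ‖)) ^ 2 :=
        pow_le_pow_left₀ (norm_nonneg _) h1 2
    _ = (l⁻¹ + c₀ ^ 2) ^ 2 * (‖coproj (V ⊓ W) φ‖ + ‖psi ι W l φ‖) ^ 2 := by ring
    _ ≤ (l⁻¹ + c₀ ^ 2) ^ 2 * (2 * defect ι V W l φ) := by
        refine mul_le_mul_of_nonneg_left ?_ (sq_nonneg _)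
        exact add_sq_le
    _ = _ := by ring

/-- Compare in the weak norm: `l⁻¹‖φ‖² = |φ|² ≤ 2|φ - S₂φ|² + 2|S₂φ|²`, and `σ ≤ l⁻¹/4` lets the
first term be absorbed on the left. -/
theorem norm_sq_le_norm_proj_sq (hι : ∀ u, ‖ι u‖ ≤ c₀ * ‖u‖) {σ : ℝ}
    (hσ : ∀ u, ‖ι (proj V u - proj W u)‖ ^ 2 ≤ σ * ‖u‖ ^ 2) (hσl : σ ≤ l⁻¹ / 4)
    {φ : V.toSubmodule} (hφ : φ ∈ eigSp ι V l⁻¹) :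
    l⁻¹ * ‖φ‖ ^ 2 ≤ 4 * c₀ ^ 2 * ‖proj W (φ : H)‖ ^ 2 := by
  have e3 := congrArg RCLike.re (inner_ambientOp ι V (φ : H) (φ : H))
  rw [(mem_eigSp_iff ι V _ φ).1 hφ, inner_smul_left, proj_eq_self φ.2, RCLike.conj_ofReal,
    RCLike.re_ofReal_mul, inner_self_eq_norm_sq, inner_self_eq_norm_sq] at e3
  have h1 := hσ φ
  rw [proj_eq_self φ.2, map_sub] at h1
  have h2 := pow_le_pow_left₀ (norm_nonneg _) (hι (proj W (φ : H))) 2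
  have h3 : ‖ι (φ : H)‖ ≤ ‖ι (φ : H) - ι (proj W (φ : H))‖ + ‖ι (proj W (φ : H))‖ :=
    norm_le_norm_sub_add _ _
  have h4 := pow_le_pow_left₀ (norm_nonneg _) h3 2
  have h5 := add_sq_le (a := ‖ι (φ : H) - ι (proj W (φ : H))‖) (b := ‖ι (proj W (φ : H))‖)
  have h6 := mul_le_mul_of_nonneg_right hσl (sq_nonneg ‖(φ : H)‖)
  rw [mul_pow] at h2
  rw [Submodule.coe_norm]
  nlinarith

/-- Test the problem with the eigenvector itself: the left side is of second order, and `‖S₂φ‖` is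
bounded below. -/
theorem norm_tau_le (hl : 0 < l) (hι : ∀ u, ‖ι u‖ ≤ c₀ * ‖u‖) {σ : ℝ}
    (hσ : ∀ u, ‖ι (proj V u - proj W u)‖ ^ 2 ≤ σ * ‖u‖ ^ 2) (hσl : σ ≤ l⁻¹ / 4)
    (hg : IsGreatest (rhoSet ι V W l) (rhoZero ι V W l)) {τ : 𝕜} (hτ : IsTau ι V W l τ) :
    ‖τ‖ ≤ 8 * c₀ ^ 2 * rhoZero ι V W l := by
  obtain ⟨φ, hφ, hφ0, h⟩ := hτ
  have hli : 0 < l⁻¹ := inv_pos.2 hl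
  have hn := congrArg norm (h φ hφ)
  rw [norm_mul, norm_mul, RCLike.norm_ofReal, abs_of_pos hli,
    inner_self_eq_norm_sq_to_K (proj W (φ : H)), norm_pow, RCLike.norm_ofReal, sq_abs] at hn
  have h1 := norm_inner_psi_le (W := W) hl.ne' hφ
  have h2 := pow_le_pow_left₀ (norm_nonneg _) (norm_coproj_le_norm_coproj_inf V W (φ : H)) 2
  have h4 : ‖(inner 𝕜 (φ : H) (psi ι W l (φ : H) : H) : 𝕜)‖
      = ‖(inner 𝕜 (psi ι W l (φ : H) : H) (φ : H) : 𝕜)‖ := norm_inner_symm _ _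
  have h5 : ‖(inner 𝕜 (psi ι W l (φ : H) : H) (psi ι W l (φ : H) : H)
        - inner 𝕜 (coproj W (φ : H)) (coproj W (φ : H))
        - inner 𝕜 (psi ι W l (φ : H) : H) (φ : H)
        - inner 𝕜 (φ : H) (psi ι W l (φ : H) : H) : 𝕜)‖ ≤ 2 * defect ι V W l φ := by
    refine (norm_sub_le _ _).trans ?_
    have h6 := norm_sub_le (inner 𝕜 (psi ι W l (φ : H) : H) (psi ι W l (φ : H) : H)
        - inner 𝕜 (coproj W (φ : H)) (coproj W (φ : H)) : 𝕜)
        (inner 𝕜 (psi ι W l (φ : H) : H) (φ : H))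
    have h7 := norm_sub_le (inner 𝕜 (psi ι W l (φ : H) : H) (psi ι W l (φ : H) : H) : 𝕜)
      (inner 𝕜 (coproj W (φ : H)) (coproj W (φ : H)))
    rw [inner_self_eq_norm_sq_to_K, inner_self_eq_norm_sq_to_K, norm_pow, norm_pow,
      RCLike.norm_ofReal, RCLike.norm_ofReal, sq_abs, sq_abs, ← inner_self_eq_norm_sq_to_K,
      ← inner_self_eq_norm_sq_to_K, ← Submodule.coe_norm] at h7
    have h8 : ‖psi ι W l (φ : H)‖ ^ 2 + ‖coproj W (φ : H)‖ ^ 2 ≤ defect ι V W l φ := by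
      unfold defect
      linarith
    linarith
  have h6 := norm_sq_le_norm_proj_sq hι hσ hσl hφ
  have h7 := defect_le hg hφ
  have h8 : ‖τ‖ * ‖proj W (φ : H)‖ ^ 2 ≤ l⁻¹ * (2 * (rhoZero ι V W l * ‖φ‖ ^ 2)) := by
    rw [← hn]
    exact mul_le_mul_of_nonneg_left (h5.trans (by linarith)) hli.le
  have hφn : 0 < ‖φ‖ := norm_pos_iff.2 hφ0
  refine le_of_mul_le_mul_right ?_ (show 0 < l⁻¹ * ‖φ‖ ^ 2 by positivity)
  calc ‖τ‖ * (l⁻¹ * ‖φ‖ ^ 2) ≤ ‖τ‖ * (4 * c₀ ^ 2 * ‖proj W (φ : H)‖ ^ 2) := by gcongr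
    _ = 4 * c₀ ^ 2 * (‖τ‖ * ‖proj W (φ : H)‖ ^ 2) := by ring
    _ ≤ 4 * c₀ ^ 2 * (l⁻¹ * (2 * (rhoZero ι V W l * ‖φ‖ ^ 2))) := by gcongr
    _ = _ := by ring

end Psi

/-! ### Locating eigenvalues relative to the gaps -/

section EigenvalueSeq

variable {ι : H →L[𝕜] HH} {V W : ClosedSubmodule 𝕜 H} {lam : ℕ → ℝ} {m : ℕ}

theorem IsEigenvalueSeq.eigenvalue_cases (hseq : IsEigenvalueSeq ι V lam) (m : ℕ) {κ : ℝ}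
    (hκ : HasEigenvalue (ambientOp ι V : End 𝕜 H) (κ : 𝕜)) :
    κ ≤ (lam (m + 1))⁻¹ ∨ κ = (lam m)⁻¹ ∨ ∃ j, j + 1 = m ∧ (lam j)⁻¹ ≤ κ := by
  -- Zero can be an eigenvalue of the extension though it is not listed by `lam`.
  by_cases h0 : κ = 0
  · exact Or.inl (h0 ▸ (inv_pos.2 (hseq.pos _)).le)
  obtain ⟨j, rfl⟩ := (hseq.isEig_iff κ).1 ((isEig_iff_hasEigenvalue ι V h0).2 hκ)
  have hanti : ∀ {i k : ℕ}, i ≤ k → (lam k)⁻¹ ≤ (lam i)⁻¹ := fun h =>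
    inv_anti₀ (hseq.pos _) (hseq.strictMono.monotone h)
  rcases lt_trichotomy j m with h | rfl | h
  · obtain ⟨i, rfl⟩ : ∃ i, m = i + 1 := ⟨m - 1, by omega⟩
    exact Or.inr (Or.inr ⟨i, rfl, hanti (by omega)⟩)
  · exact Or.inr (Or.inl rfl)
  · exact Or.inl (hanti h)

variable {g r : ℝ}

theorem IsEigenvalueSeq.gap_le_abs_sub (hseq : IsEigenvalueSeq ι V lam)
    (h1 : g ≤ (lam m)⁻¹ - (lam (m + 1))⁻¹) (h2 : ∀ j, j + 1 = m → g ≤ (lam j)⁻¹ - (lam m)⁻¹)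
    {κ : ℝ} (hne : κ ≠ (lam m)⁻¹) (hκ : HasEigenvalue (ambientOp ι V : End 𝕜 H) (κ : 𝕜)) :
    g ≤ |κ - (lam m)⁻¹| := by
  rcases hseq.eigenvalue_cases m hκ with h | h | ⟨j, hj, h⟩
  · rw [abs_sub_comm]
    exact le_trans (by linarith) (le_abs_self _)
  · exact absurd h hne
  · exact le_trans (by linarith [h2 j hj]) (le_abs_self _)

theorem sub_le_abs_sub_of_notMem_gapInterval
    (h1 : g ≤ (lam m)⁻¹ - (lam (m + 1))⁻¹) (h2 : ∀ j, j + 1 = m → g ≤ (lam j)⁻¹ - (lam m)⁻¹)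
    {ν : ℝ} (hν : ν ∉ gapInterval lam m r) : g - r ≤ |ν - (lam m)⁻¹| := by
  by_cases h : (lam (m + 1))⁻¹ + r < ν
  · obtain ⟨j, hj, h'⟩ : ∃ j, j + 1 = m ∧ (lam j)⁻¹ - r ≤ ν := by
      by_contra! hcon
      exact hν ⟨h, hcon⟩
    exact le_trans (by linarith [h2 j hj]) (le_abs_self _)
  · rw [abs_sub_comm]
    exact le_trans (by linarith) (le_abs_self _)

theorem nearInterval_subset_gapInterval (hrg : r + r < g)
    (h1 : g ≤ (lam m)⁻¹ - (lam (m + 1))⁻¹) (h2 : ∀ j, j + 1 = m → g ≤ (lam j)⁻¹ - (lam m)⁻¹) :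
    nearInterval lam m r ⊆ gapInterval lam m r := by
  rintro ν ⟨h3, h4⟩
  exact ⟨by linarith, fun j hj => by linarith [h2 j hj]⟩

theorem IsEigenvalueSeq.mem_nearInterval (hseq : IsEigenvalueSeq ι V lam)
    (hc : IsCompactOperator ι)
    (hr : ∀ u, ‖ambientOp ι V u - ambientOp ι W u‖ ≤ r * ‖u‖) {ν : ℝ}
    (hν : ν ∈ gapInterval lam m r) (he : HasEigenvalue (ambientOp ι W : End 𝕜 H) (ν : 𝕜)) :
    ν ∈ nearInterval lam m r := by
  by_contra hcon
  have hfar : r < |ν - (lam m)⁻¹| := by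
    by_contra! h
    obtain ⟨h1, h2⟩ := abs_le.1 h
    exact hcon ⟨by linarith, by linarith⟩
  have hr0 : 0 ≤ r := by
    obtain ⟨u, hu⟩ := he.exists_hasEigenvector
    have := (norm_nonneg _).trans (hr u)
    exact nonneg_of_mul_nonneg_left this (norm_pos_iff.2 hu.2)
  -- `e` is the distance to the upper neighbour; for `m = 0` there is none, and any number above `r`
  -- serves.
  obtain ⟨e, hre, he'⟩ : ∃ e, r < e ∧ ∀ j, j + 1 = m → e ≤ (lam j)⁻¹ - ν := by
    cases m with
    | zero => exact ⟨r + 1, by linarith, fun j hj => absurd hj (Nat.succ_ne_zero j)⟩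
    | succ k =>
      refine ⟨(lam k)⁻¹ - ν, by linarith [hν.2 k rfl], fun j hj => ?_⟩
      obtain rfl : j = k := by omega
      exact le_rfl
  have hd : r < min (min (ν - (lam (m + 1))⁻¹) |ν - (lam m)⁻¹|) e :=
    lt_min (lt_min (by linarith [hν.1]) hfar) hre
  refine absurd (le_of_hasEigenvalue_of_norm_sub_le (isCompactOperator_ambientOp V hc)
    (ambientOp_isSymmetric ι V) hr (hr0.trans hd.le) (fun κ hκ => ?_) he) (not_le.2 hd)
  rcases hseq.eigenvalue_cases m hκ with h | rfl | ⟨j, hj, h⟩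
  · refine ((min_le_left _ _).trans (min_le_left _ _)).trans ?_
    rw [abs_sub_comm]
    exact le_trans (by linarith) (le_abs_self _)
  · refine ((min_le_left _ _).trans (min_le_right _ _)).trans ?_
    rw [abs_sub_comm]
  · exact (min_le_right _ _).trans (le_trans (by linarith [he' j hj]) (le_abs_self _))

theorem abs_sub_le_rhoZero {ν c₀ d : ℝ} {s : Set ℝ} (hc : IsCompactOperator ι)
    (hl : 0 < lam m) (hc₀ : 0 ≤ c₀) (hι : ∀ u, ‖ι u‖ ≤ c₀ * ‖u‖) (hd : 0 < d)
    (hg : IsGreatest (rhoSet ι V W (lam m)) (rhoZero ι V W (lam m)))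
    (hr : ∀ u, ‖ambientOp ι V u - ambientOp ι W u‖ ≤ d / 2 * ‖u‖)
    (h3 : ∀ κ ∉ s, HasEigenvalue (ambientOp ι W : End 𝕜 H) (κ : 𝕜) → d ≤ |κ - (lam m)⁻¹|)
    (hX : ∀ w ∈ spectralSubspace (ambientOp ι W) s,
      ∃ x ∈ eigenspace (ambientOp ι V : End 𝕜 H) (((lam m)⁻¹ : ℝ) : 𝕜),
        x - w ∈ (spectralSubspace (ambientOp ι W) s)ᗮ)
    (hνs : ν ∈ s) (hν : HasEigenvalue (ambientOp ι W : End 𝕜 H) (ν : 𝕜)) :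
    |ν - (lam m)⁻¹| ≤ 4 * ((3 * (lam m)⁻¹ + c₀ ^ 2) + 2 * ((lam m)⁻¹ + c₀ ^ 2) ^ 2 / d)
      * rhoZero ι V W (lam m) := by
  obtain ⟨w, hw, hw0⟩ := hν.exists_hasEigenvector
  have hw' : ambientOp ι W w = (ν : 𝕜) • w := by simpa using mem_eigenspace_iff.1 hw
  have hws := eigenspace_le_spectralSubspace (ambientOp ι W) hνs hw
  obtain ⟨x, hx, hxw⟩ := hX w hws
  have hli : 0 < (lam m)⁻¹ := inv_pos.2 hl
  have hres := norm_map_sub_smul_le_of_mem_eigenspace hr hx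
  rw [← map_eigSp ι V hli.ne'] at hx
  obtain ⟨φ, hφ, rfl⟩ := hx
  have hD := defect_le hg hφ
  refine (abs_eigenvalue_sub_le (isCompactOperator_ambientOp W hc) (ambientOp_isSymmetric ι W) hd
    h3 hws hw0 hw' hxw hres (R := 2 * ((lam m)⁻¹ + c₀ ^ 2) ^ 2 * rhoZero ι V W (lam m))
    (Q := (3 * (lam m)⁻¹ + c₀ ^ 2) * rhoZero ι V W (lam m)) ?_ ?_).trans_eq ?_
  · refine (sq_norm_ambientOp_sub_smul_le (V := V) hl hc₀ hι _).trans ?_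
    rw [mul_assoc _ (rhoZero ι V W (lam m))]
    exact mul_le_mul_of_nonneg_left hD (by positivity)
  · refine (norm_inner_ambientOp_sub_smul_le hl hι hφ).trans ?_
    rw [mul_assoc _ (rhoZero ι V W (lam m))]
    exact mul_le_mul_of_nonneg_left hD (by positivity)
  · ring

end EigenvalueSeq

end EigPert

end

/-- Indices start at `0`: `lam j` is the eigenvalue usually written `λ_{j+1}`. The constants
`σ₀`, `c`, `C` depend only on `lam 0, …, lam (m + 1)` and on `c₀`. -/
theorem corollary2 {𝕜 : Type*} [RCLike 𝕜] (m : ℕ) (lam₀ : Fin (m + 2) → ℝ) (c₀ : ℝ) :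
    ∃ σ₀ c C : ℝ, 0 < σ₀ ∧ 0 < c ∧ 0 < C ∧
      ∀ (H : Type*) [NormedAddCommGroup H] [InnerProductSpace 𝕜 H] [CompleteSpace H]
        (HH : Type*) [NormedAddCommGroup HH] [InnerProductSpace 𝕜 HH] [CompleteSpace HH]
        (ι : H →L[𝕜] HH) (H₁ H₂ : ClosedSubmodule 𝕜 H) (lam : ℕ → ℝ) (σ : ℝ),
        IsCompactOperator ι → Function.Injective ι → (∀ u : H, ‖ι u‖ ≤ c₀ * ‖u‖) →
        ¬ FiniteDimensional 𝕜 H₁.toSubmodule → ¬ FiniteDimensional 𝕜 H₂.toSubmodule →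
        EigPert.IsEigenvalueSeq ι H₁ lam → (∀ j : Fin (m + 2), lam j = lam₀ j) →
        (∀ u : H, ‖ι (EigPert.proj H₁ u - EigPert.proj H₂ u)‖ ^ 2 ≤ σ * ‖u‖ ^ 2) → σ ≤ σ₀ →
        -- the eigenvalues of `K₂` near `(lam m)⁻¹`
        (EigPert.eigCount ι H₂ (EigPert.gapInterval lam m (c * √σ))
            = Module.finrank 𝕜 (EigPert.eigSp ι H₁ (lam m)⁻¹) ∧
          EigPert.eigCount ι H₂ (EigPert.nearInterval lam m (c * √σ))
            = Module.finrank 𝕜 (EigPert.eigSp ι H₁ (lam m)⁻¹) ∧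
          (∀ ν ∈ EigPert.gapInterval lam m (c * √σ), EigPert.IsEig ι H₂ ν →
            ν ∈ EigPert.nearInterval lam m (c * √σ))) ∧
        -- `ρ₀` is an attained maximum
        IsGreatest (EigPert.rhoSet ι H₁ H₂ (lam m)) (EigPert.rhoZero ι H₁ H₂ (lam m)) ∧
        -- `(Ψ_φ, χ) = (Ψ_φ, T₀ χ)`
        (∀ φ ∈ EigPert.eigSp ι H₁ (lam m)⁻¹, ∀ χ ∈ EigPert.eigSp ι H₁ (lam m)⁻¹,
          inner 𝕜 (EigPert.psi ι H₂ (lam m) (φ : H) : H) (χ : H)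
            = inner 𝕜 (EigPert.psi ι H₂ (lam m) (φ : H) : H)
                (EigPert.coproj (H₁ ⊓ H₂) (χ : H))) ∧
        -- `|τ_k| ≤ C ρ₀`
        (∀ τ : 𝕜, EigPert.IsTau ι H₁ H₂ (lam m) τ →
          ‖τ‖ ≤ C * EigPert.rhoZero ι H₁ H₂ (lam m)) ∧
        -- `|μ_k⁻¹ - λ_m⁻¹| ≤ C ρ₀`
        (∀ μ : ℝ, EigPert.IsEig ι H₂ μ⁻¹ → μ⁻¹ ∈ EigPert.nearInterval lam m (c * √σ) →
          |μ⁻¹ - (lam m)⁻¹| ≤ C * EigPert.rhoZero ι H₁ H₂ (lam m)) := by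
  -- The constants must be built from `lam₀` before `lam` is given. `Fin.ofNat` reduces modulo `m +
  -- 2`, which leaves the indices used here unchanged.
  set a : ℝ := (lam₀ (Fin.ofNat _ m))⁻¹ with ha
  set b : ℝ := (lam₀ (Fin.ofNat _ (m + 1)))⁻¹ with hb
  -- For `m = 0` the missing upper gap is replaced by the harmless positive value `a`.
  set g : ℝ := min (a - b) (if m = 0 then a else (lam₀ (Fin.ofNat _ (m - 1)))⁻¹ - a) with hg
  -- If this fails, no data satisfy the hypotheses, and any constants do.
  by_cases hpos : 0 < a ∧ 0 < g ∧ 0 < c₀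
  swap
  · refine ⟨1, 1, 1, one_pos, one_pos, one_pos, ?_⟩
    intro H _ _ _ HH _ _ _ ι H₁ H₂ lam σ hc hinj hι hd₁ hd₂ hseq hlam hσ hσ₀
    refine absurd ?_ hpos
    have hla : ∀ j, j < m + 2 → lam₀ (Fin.ofNat _ j) = lam j := fun j hj => by
      rw [← hlam, Fin.val_ofNat, Nat.mod_eq_of_lt hj]
    have hlt : ∀ {i k : ℕ}, i < k → (lam k)⁻¹ < (lam i)⁻¹ := fun h =>
      inv_strictAnti₀ (hseq.pos _) (hseq.strictMono h)
    rw [hg, ha, hb, hla m (by omega), hla (m + 1) (by omega), hla (m - 1) (by omega)]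
    refine ⟨inv_pos.2 (hseq.pos m), lt_min (sub_pos.2 (hlt (Nat.lt_succ_self m))) ?_, ?_⟩
    · split_ifs with h0
      · exact inv_pos.2 (hseq.pos m)
      · exact sub_pos.2 (hlt (by omega))
    · have hnt : Nontrivial H₁.toSubmodule := by
        by_contra hn
        have := not_nontrivial_iff_subsingleton.1 hn
        exact hd₁ inferInstance
      obtain ⟨x, hx⟩ := exists_ne (0 : H₁.toSubmodule)
      have hx0 : (x : H) ≠ 0 := by simpa using hx
      have h1 : 0 < ‖ι x‖ := norm_pos_iff.2 ((map_ne_zero_iff ι hinj).2 hx0)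
      exact pos_of_mul_pos_left (h1.trans_le (hι x)) (norm_nonneg _)
  obtain ⟨ha0, hg0, hc₀⟩ := hpos
  -- `a / 4` serves the lower bound for `‖S₂φ‖`. The other entry gives `r ≤ g / 4`, hence `2r < g`,
  -- distance at least `g / 2` outside the gap interval, and the residual bound `d / 2` for `d = g /
  -- 2`. The third constant adds those for `μ` and `τ`.
  refine ⟨min (a / 4) ((g / (8 * c₀)) ^ 2), 2 * c₀,
    4 * ((3 * a + c₀ ^ 2) + 2 * (a + c₀ ^ 2) ^ 2 / (g / 2)) + 8 * c₀ ^ 2,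
    by positivity, by positivity, by positivity, ?_⟩
  intro H _ _ _ HH _ _ _ ι H₁ H₂ lam σ hc hinj hι hd₁ hd₂ hseq hlam hσ hσ₀
  have hla : ∀ j, j < m + 2 → lam₀ (Fin.ofNat _ j) = lam j := fun j hj => by
    rw [← hlam, Fin.val_ofNat, Nat.mod_eq_of_lt hj]
  rw [hla m (by omega)] at ha
  rw [hla (m + 1) (by omega)] at hb
  rw [hla (m - 1) (by omega)] at hg
  have hl : 0 < lam m := hseq.pos m
  have hg1 : g ≤ (lam m)⁻¹ - (lam (m + 1))⁻¹ := by
    rw [← ha, ← hb, hg]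
    exact min_le_left _ _
  have hg2 : ∀ j, j + 1 = m → g ≤ (lam j)⁻¹ - (lam m)⁻¹ := by
    intro j hj
    have h := hg.trans_le (min_le_right _ _)
    rw [if_neg (by omega), show m - 1 = j by omega, ha] at h
    exact h
  set r : ℝ := 2 * c₀ * √σ with hrdef
  have hr0 : 0 ≤ r := by positivity
  have hrg : r ≤ g / 4 := by
    have h1 : √σ ≤ g / (8 * c₀) :=
      (Real.sqrt_le_left (by positivity)).2 (hσ₀.trans (min_le_right _ _))
    calc r ≤ 2 * c₀ * (g / (8 * c₀)) := mul_le_mul_of_nonneg_left h1 (by positivity)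
      _ = g / 4 := by field_simp; ring
  have hσs : ∀ u, ‖ι (EigPert.proj H₁ u - EigPert.proj H₂ u)‖ ≤ √σ * ‖u‖ := by
    intro u
    rw [← Real.sqrt_sq (norm_nonneg (ι _)), ← Real.sqrt_sq (norm_nonneg u),
      ← Real.sqrt_mul' _ (sq_nonneg _)]
    simpa using Real.sqrt_le_sqrt (hσ u)
  have hr := EigPert.norm_ambientOp_sub_le H₁ H₂ hc₀.le hι hσs
  have hcA := EigPert.isCompactOperator_ambientOp H₁ hc
  have hcB := EigPert.isCompactOperator_ambientOp H₂ hc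
  have hli : 0 < (lam m)⁻¹ := inv_pos.2 hl
  have hb0 : 0 < (lam (m + 1))⁻¹ := inv_pos.2 (hseq.pos _)
  have hfar : ∀ ν ∉ EigPert.gapInterval lam m r, Module.End.HasEigenvalue
      (EigPert.ambientOp ι H₂ : Module.End 𝕜 H) (ν : 𝕜) → g / 2 ≤ |ν - (lam m)⁻¹| := fun ν hν _ =>
    le_trans (by linarith) (EigPert.sub_le_abs_sub_of_notMem_gapInterval hg1 hg2 hν)
  have hnear : ∀ ν ∈ EigPert.gapInterval lam m r, Module.End.HasEigenvalue
      (EigPert.ambientOp ι H₂ : Module.End 𝕜 H) (ν : 𝕜) → ν ∈ EigPert.nearInterval lam m r :=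
    fun ν hν he => hseq.mem_nearInterval hc hr hν he
  have hsub := EigPert.nearInterval_subset_gapInterval (r := r) (by linarith) hg1 hg2
  -- Away from zero the multiplicities of `K₂` and of its extension agree.
  have hgap0 : (0 : ℝ) ∉ EigPert.gapInterval lam m r := fun h => by linarith [h.1]
  obtain ⟨hrank, hX⟩ := EigPert.finrank_spectralSubspace_eq (d := g / 2) (g := g) hcA
    (EigPert.ambientOp_isSymmetric ι H₁) hcB (EigPert.ambientOp_isSymmetric ι H₂) hli.ne' hr0 hr
    (by linarith) (by linarith) (fun κ hne hκ => hseq.gap_le_abs_sub hg1 hg2 hne hκ)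
    (fun ν hν he => abs_le.2 ⟨by linarith [(hnear ν hν he).1], by linarith [(hnear ν hν he).2]⟩)
    hfar
  have hfd₀ : FiniteDimensional 𝕜
      (Module.End.eigenspace (EigPert.ambientOp ι H₁ : Module.End 𝕜 H) (((lam m)⁻¹ : ℝ) : 𝕜)) :=
    ContinuousLinearMap.finite_dimensional_eigenspace hcA _ (by exact_mod_cast hli.ne')
  have hfd : FiniteDimensional 𝕜 (EigPert.eigSp ι H₁ (lam m)⁻¹) := by
    rw [← EigPert.map_eigSp ι H₁ hli.ne'] at hfd₀
    exact Module.Finite.equiv (Submodule.equivSubtypeMap _ _).symm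
  have hgr : IsGreatest (EigPert.rhoSet ι H₁ H₂ (lam m)) (EigPert.rhoZero ι H₁ H₂ (lam m)) :=
    EigPert.isGreatest_rhoZero ((hseq.isEig_iff _).2 ⟨m, rfl⟩)
  have hρ : 0 ≤ EigPert.rhoZero ι H₁ H₂ (lam m) := by
    obtain ⟨φ, -, -, h⟩ := hgr.1
    rw [h]
    positivity
  rw [ha]
  refine ⟨⟨?_, ?_, ?_⟩, hgr, ?_, ?_, ?_⟩
  · rw [EigPert.eigCount_eq ι H₂ hgap0, EigPert.finrank_eigSp ι H₁ hli.ne', hrank]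
  · rw [EigPert.eigCount_eq ι H₂ (fun h => hgap0 (hsub h)), EigPert.finrank_eigSp ι H₁ hli.ne',
      ← hrank, EigPert.spectralSubspace_congr _ fun ν he => ⟨fun h => hsub h, fun h => hnear ν h he⟩]
  · intro ν hν he
    refine hnear ν hν ((EigPert.isEig_iff_hasEigenvalue ι H₂ ?_).1 he)
    rintro rfl
    exact hgap0 hν
  · intro φ hφ χ _
    exact EigPert.inner_psi_eq_coproj hl.ne' hφ χ
  · intro τ hτ
    refine (EigPert.norm_tau_le hl hι hσ ?_ hgr hτ).trans (mul_le_mul_of_nonneg_right ?_ hρ)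
    · rw [← ha]
      exact hσ₀.trans (min_le_left _ _)
    · exact le_add_of_nonneg_left (by positivity)
  · intro μ he hμ
    have hμ0 : μ⁻¹ ≠ 0 := fun h => hgap0 (h ▸ hsub hμ)
    refine (EigPert.abs_sub_le_rhoZero hc hl hc₀.le hι (half_pos hg0) hgr (fun u => ?_) hfar hX
      (hsub hμ) ((EigPert.isEig_iff_hasEigenvalue ι H₂ hμ0).1 he)).trans
      (mul_le_mul_of_nonneg_right (le_add_of_nonneg_right (by positivity)) hρ)
    exact (hr u).trans (mul_le_mul_of_nonneg_right (by linarith) (norm_nonneg u))
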